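/- Let $K$ be an algebraically closed field of characteristic zero and let $Z=\{P_1,\dots,P_r\}\subset\mathbb{P}^2_K$ be a finite set of points. Let $I(P_i)\subset K[x_0,x_1,x_2]$ be the homogeneous ideal of $P_i$ and put $I=I(P_1)\cap\dots\cap I(P_r)$ and $I^{(k)}=I(P_1)^k\cap\dots\cap I(P_r)^k$ for $k\ge 1$ (so $I^{(1)}=I$). For a nonzero homogeneous ideal $J$ let $\alpha(J)$ be the least degree of a nonzero homogeneous polynomial in $J$. 1. If $Z\neq\emptyset$, then $\alpha(I^{(k)})-\alpha(I)\ge k-1$ for every integer $k\ge 1$. 2. If $\alpha(I^{(k)})-\alpha(I)=k-1$ for some integer $k\ge 3$, then the points of $Z$ are collinear, i.e. $Z$ is contained in a line of $\mathbb{P}^2_K$. 3. If $\alpha(I^{(2)})-\alpha(I)=\alpha(I^{(3)})-\alpha(I^{(2)})=\dots=\alpha(I^{(k+1)})-\alpha(I^{(k)})=1$ for some integer $k\ge 2$, then $Z$ is contained in a line and $\alpha(I)=1$. -/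

import Mathlib

namespace PlanarPoints

/-- The projective plane over `K`: lines through the origin in `K³`. -/
abbrev Plane (K : Type*) [Field K] : Type _ := Projectivization K (Fin 3 → K)

/-- The homogeneous ideal `I(P)` of a point `P` in `K[x₀, x₁, x₂]`: the ideal generated by the
homogeneous polynomials vanishing at `P`. For a homogeneous polynomial, vanishing at `P` does not
depend on the representative vector of `P`. -/
noncomputable def pointIdeal {K : Type*} [Field K] (P : Plane K) :
    Ideal (MvPolynomial (Fin 3) K) :=
  Ideal.span {f | (∃ n : ℕ, f.IsHomogeneous n) ∧ MvPolynomial.eval P.rep f = 0}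

/-- The ideal `I(Z)` of a finite set of points: the intersection of the ideals of the points. -/
noncomputable def idealOf {K : Type*} [Field K] (Z : Finset (Plane K)) :
    Ideal (MvPolynomial (Fin 3) K) :=
  ⨅ P ∈ Z, pointIdeal P

/-- The `k`-th symbolic power of `I(Z)`: the intersection of the `k`-th powers of the ideals of
the points. -/
noncomputable def symbolicPower {K : Type*} [Field K] (Z : Finset (Plane K)) (k : ℕ) :
    Ideal (MvPolynomial (Fin 3) K) :=
  ⨅ P ∈ Z, pointIdeal P ^ k

theorem symbolicPower_one {K : Type*} [Field K] (Z : Finset (Plane K)) :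
    symbolicPower Z 1 = idealOf Z := by
  simp [symbolicPower, idealOf]

/-- The initial degree of a (nonzero, homogeneous) ideal: the least `n` such that the ideal
contains a nonzero homogeneous polynomial of degree `n`. -/
noncomputable def initialDegree {K : Type*} [Field K]
    (I : Ideal (MvPolynomial (Fin 3) K)) : ℕ :=
  sInf {n : ℕ | ∃ f ∈ I, f ≠ 0 ∧ f.IsHomogeneous n}

/-- A set of points is collinear if it is contained in a line of the projective plane, that is,
in the projectivization of a two-dimensional linear subspace of `K³`. -/
def IsCollinear {K : Type*} [Field K] (Z : Finset (Plane K)) : Prop :=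
  ∃ W : Submodule K (Fin 3 → K), Module.finrank K W = 2 ∧ ∀ P ∈ Z, P.submodule ≤ W

end PlanarPoints

open MvPolynomial

namespace PlanarPoints

/-! Partial derivatives send `I^(k+1)` into `I^(k)`, and in characteristic zero some derivative of a
nonconstant form is nonzero. Hence `α` grows by at least one at each step (`initialDegree_succ`),
which gives the first claim and reduces the other two to this: `α(I^(3)) ≤ α(I) + 2` forces `α(I) =
1`, an equation of a line through `Z`.

With `n + 1 = α(I)` and `d = α(I^(3))`, Chudnovsky's inequality `3(n + 2) ≤ 2d`
(`three_mul_le_two_mul`) suffices. Shrink `Z` to a minimal `W` lying on no curve of degree `n`, so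
that `|W| ≥ (n+1)(n+2)/2`. The curves of degree `n + 1` through `W` have no common component, so one
of them is coprime to a form `f` of degree `d` with triple points on `W` (`exists_isRelPrime`).
Bézout (`three_mul_card_le`) gives `3|W| ≤ (n + 1)d`. It is proved by counting dimensions in one
large degree, with the second derivatives at `W` as test functionals. -/

/-! ### Homogeneous polynomials: factors and dimensions -/

/-- The ring homomorphism `f(x) ↦ f(t x)`. -/
noncomputable def scaling (σ R : Type*) [CommRing R] :
    MvPolynomial σ R →ₐ[R] Polynomial (MvPolynomial σ R) :=
  aeval fun i => Polynomial.X * Polynomial.C (X i)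

theorem scaling_monomial {σ R : Type*} [CommRing R] (d : σ →₀ ℕ) (r : R) :
    scaling σ R (monomial d r) = Polynomial.monomial d.degree (monomial d r) := by
  rw [scaling, aeval_monomial, ← Polynomial.C_mul_X_pow_eq_monomial]
  simp only [mul_pow, Finsupp.prod, Finset.prod_mul_distrib, Finset.prod_pow_eq_pow_sum]
  rw [monomial_eq, Finsupp.prod, Finsupp.degree_apply]
  simp only [map_mul, map_prod, map_pow]
  rw [IsScalarTower.algebraMap_apply R (MvPolynomial σ R) (Polynomial (MvPolynomial σ R)),
    Polynomial.algebraMap_eq, MvPolynomial.algebraMap_eq]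
  change _ * (Polynomial.X ^ (∑ i ∈ d.support, d i) * _) = _
  ring

theorem coeff_scaling {σ R : Type*} [CommRing R] (f : MvPolynomial σ R) (n : ℕ) :
    (scaling σ R f).coeff n = homogeneousComponent n f := by
  induction f using MvPolynomial.induction_on' with
  | monomial d r =>
    rw [scaling_monomial, Polynomial.coeff_monomial,
      homogeneousComponent_of_mem (isHomogeneous_monomial r rfl)]
    simp only [eq_comm]
  | add p q hp hq => rw [map_add, Polynomial.coeff_add, hp, hq, map_add]

theorem scaling_of_isHomogeneous {σ R : Type*} [CommRing R] {f : MvPolynomial σ R} {n : ℕ}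
    (hf : f.IsHomogeneous n) : scaling σ R f = Polynomial.monomial n f := by
  ext1 k
  rw [coeff_scaling, Polynomial.coeff_monomial, homogeneousComponent_of_mem hf]
  simp only [eq_comm]

/-- As polynomials in `t`, the lowest and highest degrees of `f(tx)` and `g(tx)` add up to those of
a monomial, so the two degrees agree for each factor. -/
theorem exists_isHomogeneous_of_mul {σ R : Type*} [CommRing R] [IsDomain R]
    {f g : MvPolynomial σ R} {n : ℕ} (h : (f * g).IsHomogeneous n) (hfg : f * g ≠ 0) :
    ∃ m, g.IsHomogeneous m := by
  have hf : scaling σ R f ≠ 0 := by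
    intro h0
    have := scaling_of_isHomogeneous h
    rw [map_mul, h0, zero_mul] at this
    exact hfg ((Polynomial.monomial_eq_zero_iff _ _).1 this.symm)
  have hg : scaling σ R g ≠ 0 := by
    intro h0
    have := scaling_of_isHomogeneous h
    rw [map_mul, h0, mul_zero] at this
    exact hfg ((Polynomial.monomial_eq_zero_iff _ _).1 this.symm)
  have h1 := congrArg Polynomial.natDegree (scaling_of_isHomogeneous h)
  have h2 := congrArg Polynomial.natTrailingDegree (scaling_of_isHomogeneous h)
  rw [map_mul, Polynomial.natDegree_mul hf hg, Polynomial.natDegree_monomial_eq _ hfg] at h1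
  rw [map_mul, Polynomial.natTrailingDegree_mul hf hg,
    Polynomial.natTrailingDegree_monomial hfg] at h2
  have h3 := (scaling σ R f).natTrailingDegree_le_natDegree
  have h4 := (scaling σ R g).natTrailingDegree_le_natDegree
  have key : ∀ k, k ≠ (scaling σ R g).natDegree → homogeneousComponent k g = 0 := by
    intro k hk
    rw [← coeff_scaling]
    rcases lt_or_gt_of_ne hk with hk | hk
    · exact Polynomial.coeff_eq_zero_of_lt_natTrailingDegree (by omega)
    · exact Polynomial.coeff_eq_zero_of_natDegree_lt hk
  clear h1 h2 h3 h4
  generalize (scaling σ R g).natDegree = m at key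
  refine ⟨m, ?_⟩
  rw [← sum_homogeneousComponent g]
  refine IsHomogeneous.sum _ _ _ fun k _ => ?_
  by_cases hk : k = m
  · rw [← hk]
    exact homogeneousComponent_isHomogeneous _ _
  · rw [key k hk]
    exact isHomogeneous_zero _ _ _

theorem finrank_homogeneousSubmodule {K : Type*} [Field K] (n : ℕ) :
    Module.finrank K (homogeneousSubmodule (Fin 3) K n) = (n + 2).choose 2 := by
  classical
  rw [homogeneousSubmodule_eq_finsupp_supported]
  have e : {d : Fin 3 →₀ ℕ | d.degree = n} =
      ((Finset.finsuppAntidiag (Finset.univ : Finset (Fin 3)) n : Finset _) : Set (Fin 3 →₀ ℕ)) := by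
    ext d
    simp [Finset.mem_finsuppAntidiag, Finsupp.degree_eq_sum]
  rw [e, (AddMonoidAlgebra.supportedEquivFinsupp _).finrank_eq, Module.finrank_finsupp_self]
  simp only [Finset.coe_sort_coe, Fintype.card_coe, Finset.card_finsuppAntidiag_nat_eq_choose]
  rw [Finset.card_univ, Fintype.card_fin, show 3 + n - 1 = n + 2 by omega, Nat.choose_symm_add]

theorem isHomogeneous_zero_eq_C {K : Type*} [Field K] {f : MvPolynomial (Fin 3) K}
    (hf : f.IsHomogeneous 0) : ∃ c, f = C c := by
  rw [← totalDegree_zero_iff_isHomogeneous, totalDegree_eq_zero_iff_eq_C] at hf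
  exact ⟨_, hf⟩

/-! ### Point ideals, derivatives and Euler's identity -/

section
variable {K : Type*} [Field K]

theorem eval_eq_zero_of_mem_pointIdeal {P : Plane K} {f : MvPolynomial (Fin 3) K}
    (hf : f ∈ pointIdeal P) : eval P.rep f = 0 := by
  have : pointIdeal P ≤ RingHom.ker (eval P.rep) := by
    rw [pointIdeal, Ideal.span_le]
    rintro g ⟨_, hg⟩
    exact hg
  exact this hf

theorem mem_pointIdeal {P : Plane K} {f : MvPolynomial (Fin 3) K} {n : ℕ}
    (hf : f.IsHomogeneous n) (h : eval P.rep f = 0) : f ∈ pointIdeal P :=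
  Ideal.subset_span ⟨⟨n, hf⟩, h⟩

theorem pderiv_mem_pow {R σ : Type*} [CommRing R] (J : Ideal (MvPolynomial σ R)) (i : σ) (k : ℕ) :
    ∀ f ∈ J ^ (k + 1), pderiv i f ∈ J ^ k := by
  induction k with
  | zero => simp
  | succ k ih =>
    intro f hf
    rw [pow_succ] at hf
    refine Submodule.mul_induction_on hf ?_ ?_
    · intro x hx y hy
      rw [Derivation.leibniz, smul_eq_mul, smul_eq_mul]
      refine add_mem (Ideal.mul_mem_right _ _ hx) ?_
      rw [pow_succ']
      exact Ideal.mul_mem_mul hy (ih x hx)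
    · intro x y hx hy
      rw [map_add]
      exact add_mem hx hy

theorem pderiv_mem_symbolicPower {Z : Finset (Plane K)} {k : ℕ} {f : MvPolynomial (Fin 3) K}
    (hf : f ∈ symbolicPower Z (k + 1)) (i : Fin 3) : pderiv i f ∈ symbolicPower Z k := by
  simp only [symbolicPower, Submodule.mem_iInf] at hf ⊢
  exact fun P hP => pderiv_mem_pow _ _ _ _ (hf P hP)

theorem eval_pderiv_pderiv_eq_zero {P : Plane K} {f : MvPolynomial (Fin 3) K}
    (hf : f ∈ pointIdeal P ^ 3) (i j : Fin 3) : eval P.rep (pderiv i (pderiv j f)) = 0 := by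
  have h := pderiv_mem_pow _ i 1 _ (pderiv_mem_pow _ j 2 _ hf)
  rw [pow_one] at h
  exact eval_eq_zero_of_mem_pointIdeal h

theorem eval_eq_zero_of_eval_pderiv [CharZero K] {f : MvPolynomial (Fin 3) K} {n : ℕ}
    (hf : f.IsHomogeneous n) (hn : n ≠ 0) {p : Fin 3 → K}
    (h : ∀ i, eval p (pderiv i f) = 0) : eval p f = 0 := by
  have := congrArg (eval p) hf.sum_X_mul_pderiv
  simpa [h, hn] using this.symm

theorem eq_zero_of_pderiv [CharZero K] {f : MvPolynomial (Fin 3) K} {n : ℕ}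
    (hf : f.IsHomogeneous n) (hn : n ≠ 0) (h : ∀ i, pderiv i f = 0) : f = 0 := by
  have := hf.sum_X_mul_pderiv
  simpa [h, hn] using this.symm

/-! ### Linear forms and separation of points -/

/-- The linear form with the given coefficients. -/
noncomputable def linearForm (φ : (Fin 3 → K) →ₗ[K] K) : MvPolynomial (Fin 3) K :=
  ∑ i, C (φ (Pi.single i 1)) * X i

theorem isHomogeneous_linearForm (φ : (Fin 3 → K) →ₗ[K] K) : (linearForm φ).IsHomogeneous 1 :=
  IsHomogeneous.sum _ _ _ fun _ _ => isHomogeneous_C_mul_X _ _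

theorem eval_linearForm (φ : (Fin 3 → K) →ₗ[K] K) (p : Fin 3 → K) :
    eval p (linearForm φ) = φ p := by
  conv_rhs => rw [pi_eq_sum_univ' p]
  simp [linearForm, mul_comm]

theorem exists_isHomogeneous_one_eval_ne_zero {p : Fin 3 → K} (hp : p ≠ 0) :
    ∃ l : MvPolynomial (Fin 3) K, l.IsHomogeneous 1 ∧ eval p l ≠ 0 := by
  obtain ⟨i, hi⟩ := Function.ne_iff.1 hp
  exact ⟨X i, isHomogeneous_X _ _, by simpa using hi⟩

theorem exists_isHomogeneous_one_separating {P Q : Plane K} (h : P ≠ Q) :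
    ∃ l : MvPolynomial (Fin 3) K, l.IsHomogeneous 1 ∧ eval P.rep l ≠ 0 ∧ eval Q.rep l = 0 := by
  have hPQ : P.rep ∉ Submodule.span K {Q.rep} := by
    intro hmem
    obtain ⟨c, hc⟩ := Submodule.mem_span_singleton.1 hmem
    apply h
    rw [← P.mk_rep, ← Q.mk_rep]
    exact (Projectivization.mk_eq_mk_iff' K _ _ P.rep_nonzero Q.rep_nonzero).2 ⟨c, hc⟩
  obtain ⟨φ, h1, h2⟩ := Submodule.exists_le_ker_of_notMem hPQ
  refine ⟨linearForm φ, isHomogeneous_linearForm φ, ?_, ?_⟩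
  · simpa [eval_linearForm] using h1
  · simpa [eval_linearForm] using h2 (Submodule.mem_span_singleton_self _)

theorem exists_isHomogeneous_eval_ne_zero_mem_pow (W : Finset (Plane K)) (P : Plane K)
    {k M : ℕ} (hM : k * W.card ≤ M) :
    ∃ H : MvPolynomial (Fin 3) K, H.IsHomogeneous M ∧ eval P.rep H ≠ 0 ∧
      ∀ Q ∈ W, Q ≠ P → H ∈ pointIdeal Q ^ k := by
  classical
  obtain ⟨l0, hl0, hl0'⟩ := exists_isHomogeneous_one_eval_ne_zero P.rep_nonzero
  have hex : ∀ Q : Plane K, ∃ l : MvPolynomial (Fin 3) K, l.IsHomogeneous 1 ∧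
      eval P.rep l ≠ 0 ∧ (Q ≠ P → eval Q.rep l = 0) := by
    intro Q
    by_cases hQ : Q = P
    · exact ⟨l0, hl0, hl0', fun h => absurd hQ h⟩
    · obtain ⟨l, h1, h2, h3⟩ := exists_isHomogeneous_one_separating (Ne.symm hQ)
      exact ⟨l, h1, h2, fun _ => h3⟩
  choose l h1 h2 h3 using hex
  refine ⟨(∏ Q ∈ W, l Q ^ k) * l0 ^ (M - k * W.card), ?_, ?_, ?_⟩
  · have := (IsHomogeneous.prod W (fun Q => l Q ^ k) (fun _ => 1 * k)
      fun Q _ => (h1 Q).pow k).mul (hl0.pow (M - k * W.card))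
    convert this using 1
    simp only [Finset.sum_const, smul_eq_mul, one_mul]
    rw [mul_comm W.card]; omega
  · simp only [map_mul, map_prod, map_pow]
    exact mul_ne_zero (Finset.prod_ne_zero_iff.2 fun Q _ => pow_ne_zero _ (h2 Q))
      (pow_ne_zero _ hl0')
  · intro Q hQ hQP
    refine Ideal.mul_mem_right _ _ (Ideal.mem_of_dvd _ (Finset.dvd_prod_of_mem _ hQ) ?_)
    exact Ideal.pow_mem_pow (mem_pointIdeal (h1 Q) (h3 Q hQP)) k

/-! ### Conditions imposed by derivatives at the points -/

/-- The linear map taking all second partial derivatives at the points of `W`. -/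
noncomputable def secondDerivs (W : Finset (Plane K)) :
    MvPolynomial (Fin 3) K →ₗ[K] (W → Fin 3 → Fin 3 → K) :=
  LinearMap.pi fun P => LinearMap.pi fun i => LinearMap.pi fun j =>
    (aeval (R := K) P.1.rep).toLinearMap ∘ₗ (pderiv i).toLinearMap ∘ₗ (pderiv j).toLinearMap

theorem secondDerivs_apply (W : Finset (Plane K)) (f : MvPolynomial (Fin 3) K) (P : W)
    (i j : Fin 3) : secondDerivs W f P i j = eval P.1.rep (pderiv i (pderiv j f)) := by
  simp [secondDerivs, aeval_eq_eval]

/-- The linear map taking all first partial derivatives at the points of `W`. -/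
noncomputable def firstDerivs (W : Finset (Plane K)) :
    MvPolynomial (Fin 3) K →ₗ[K] (W → Fin 3 → K) :=
  LinearMap.pi fun P => LinearMap.pi fun i =>
    (aeval (R := K) P.1.rep).toLinearMap ∘ₗ (pderiv i).toLinearMap

theorem firstDerivs_apply (W : Finset (Plane K)) (f : MvPolynomial (Fin 3) K) (P : W)
    (i : Fin 3) : firstDerivs W f P i = eval P.1.rep (pderiv i f) := by
  simp [firstDerivs, aeval_eq_eval]

instance finite_homogeneousSubmodule (n : ℕ) :
    Module.Finite K (homogeneousSubmodule (Fin 3) K n) :=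
  Module.Finite.iff_fg.2 (homogeneousSubmodule_fg _ _ n)

theorem secondDerivs_eq_zero {W : Finset (Plane K)} {f : MvPolynomial (Fin 3) K}
    (hf : f ∈ symbolicPower W 3) : secondDerivs W f = 0 := by
  simp only [symbolicPower, Submodule.mem_iInf] at hf
  ext P i j
  rw [secondDerivs_apply, eval_pderiv_pderiv_eq_zero (hf P.1 P.2)]
  rfl

/-- Euler's identity makes the lower derivatives of `s * H` vanish at `p` too. As `H(p) ≠ 0`,
Leibniz transfers this to `s` order by order; the second derivatives of a quadric are constants, so
they vanish identically. -/
theorem eq_zero_of_second_derivs_mul [CharZero K] {p : Fin 3 → K}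
    {s H : MvPolynomial (Fin 3) K} {M : ℕ} (hs : s.IsHomogeneous 2) (hH : H.IsHomogeneous M)
    (hHp : eval p H ≠ 0) (h : ∀ i j, eval p (pderiv i (pderiv j (s * H))) = 0) : s = 0 := by
  have hsH := hs.mul hH
  have h1 : ∀ j, eval p (pderiv j (s * H)) = 0 := fun j =>
    eval_eq_zero_of_eval_pderiv (hsH.pderiv (i := j)) (by omega) fun i => h i j
  have h0 : eval p (s * H) = 0 := eval_eq_zero_of_eval_pderiv hsH (by omega) h1
  have s0 : eval p s = 0 := by simpa [hHp] using h0
  have s1 : ∀ j, eval p (pderiv j s) = 0 := by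
    intro j
    simpa [Derivation.leibniz, s0, hHp] using h1 j
  have s2 : ∀ i j, eval p (pderiv i (pderiv j s)) = 0 := by
    intro i j
    simpa [Derivation.leibniz, s0, s1, hHp] using h i j
  refine eq_zero_of_pderiv hs two_ne_zero fun j => ?_
  refine eq_zero_of_pderiv (hs.pderiv (i := j)) one_ne_zero fun i => ?_
  obtain ⟨c, hc⟩ := isHomogeneous_zero_eq_C ((hs.pderiv (i := j)).pderiv (i := i))
  have := s2 i j
  rw [hc, eval_C] at this
  rw [hc, this, C_0]

/-- Each point `P` contributes the six-dimensional space of quadrics times a form `H P` that is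
nonzero at `P` and vanishes to order three at the other points, so the contributions are
independent. -/
theorem six_mul_card_le_finrank [CharZero K] (W : Finset (Plane K)) {M : ℕ}
    (hM : 3 * W.card ≤ M) :
    6 * W.card ≤ Module.finrank K
      ((homogeneousSubmodule (Fin 3) K (2 + M)).map (secondDerivs W)) := by
  classical
  choose H h1 h2 h3 using fun P : W => exists_isHomogeneous_eval_ne_zero_mem_pow W P.1 hM
  let Θ : (W → homogeneousSubmodule (Fin 3) K 2) →ₗ[K] MvPolynomial (Fin 3) K :=
    ∑ P, LinearMap.mulRight K (H P) ∘ₗ (homogeneousSubmodule (Fin 3) K 2).subtype ∘ₗ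
      LinearMap.proj P
  have hΘ : ∀ s, Θ s = ∑ P, (s P : MvPolynomial (Fin 3) K) * H P := fun s => by
    simp [Θ, LinearMap.sum_apply]
  have hmem : ∀ s, Θ s ∈ homogeneousSubmodule (Fin 3) K (2 + M) := fun s => by
    rw [hΘ]
    exact Submodule.sum_mem _ fun P _ => IsHomogeneous.mul (s P).2 (h1 P)
  have hinj : Function.Injective (secondDerivs W ∘ₗ Θ) := by
    rw [← LinearMap.ker_eq_bot, LinearMap.ker_eq_bot']
    intro s hs
    funext P
    refine Subtype.ext (eq_zero_of_second_derivs_mul (s P).2 (h1 P) (h2 P) fun i j => ?_)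
    have := congrFun (congrFun (congrFun hs P) i) j
    rw [LinearMap.comp_apply, secondDerivs_apply, hΘ, map_sum, map_sum, map_sum,
      Finset.sum_eq_single P] at this
    · exact this
    · intro Q _ hQ
      exact eval_pderiv_pderiv_eq_zero
        (Ideal.mul_mem_left _ _ (h3 Q P.1 P.2 fun h => hQ (Subtype.ext h.symm))) i j
    · simp
  have hle : LinearMap.range (secondDerivs W ∘ₗ Θ) ≤
      (homogeneousSubmodule (Fin 3) K (2 + M)).map (secondDerivs W) := by
    rintro _ ⟨s, rfl⟩
    exact Submodule.mem_map_of_mem (hmem s)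
  have := Submodule.finrank_mono hle
  rw [LinearMap.finrank_range_of_inj hinj, Module.finrank_pi_fintype] at this
  simpa [finrank_homogeneousSubmodule, Nat.choose, mul_comm] using this

/-- Since `g` vanishes at `P`, the second derivatives of `g * v` there involve only the value and
gradient of `v`. Euler's identity recovers the value from the gradient, leaving three parameters per
point. -/
theorem finrank_secondDerivs_mul_le [CharZero K] (W : Finset (Plane K))
    {g : MvPolynomial (Fin 3) K} (hg : ∀ P ∈ W, eval P.rep g = 0) {n : ℕ} (hn : n ≠ 0) :
    Module.finrank K (LinearMap.range (secondDerivs W ∘ₗ LinearMap.mulLeft K g ∘ₗ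
      (homogeneousSubmodule (Fin 3) K n).subtype)) ≤ 3 * W.card := by
  set A := secondDerivs W ∘ₗ LinearMap.mulLeft K g ∘ₗ
      (homogeneousSubmodule (Fin 3) K n).subtype
  set B := firstDerivs W ∘ₗ (homogeneousSubmodule (Fin 3) K n).subtype with hB
  have hker : LinearMap.ker B ≤ LinearMap.ker A := by
    intro v hv
    rw [LinearMap.mem_ker] at hv ⊢
    have hv1 : ∀ P ∈ W, ∀ i, eval P.rep (pderiv i (v : MvPolynomial (Fin 3) K)) = 0 :=
      fun P hP i => by
        rw [← firstDerivs_apply W _ ⟨P, hP⟩ i]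
        exact congrFun (congrFun hv ⟨P, hP⟩) i
    have hv0 : ∀ P ∈ W, eval P.rep (v : MvPolynomial (Fin 3) K) = 0 := fun P hP =>
      eval_eq_zero_of_eval_pderiv v.2 hn (hv1 P hP)
    ext P i j
    change secondDerivs W (g * (v : MvPolynomial (Fin 3) K)) P i j = 0
    rw [secondDerivs_apply]
    simp [Derivation.leibniz, hv1 P.1 P.2, hv0 P.1 P.2, hg P.1 P.2]
  have h1 := A.finrank_range_add_finrank_ker
  have h2 := B.finrank_range_add_finrank_ker
  have h3 := Submodule.finrank_mono hker
  have h4 : Module.finrank K (LinearMap.range B) ≤ 3 * W.card := by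
    refine (Submodule.finrank_le _).trans (le_of_eq ?_)
    simp [Module.finrank_pi_fintype, mul_comm]
  omega

/-! ### Syzygies and Bézout's inequality -/

/-- The linear map `(u, v) ↦ u f + v g` on forms of given degrees. -/
noncomputable def syzygyMap (f g : MvPolynomial (Fin 3) K) (m n : ℕ) :
    (homogeneousSubmodule (Fin 3) K m × homogeneousSubmodule (Fin 3) K n) →ₗ[K]
      MvPolynomial (Fin 3) K :=
  (LinearMap.mulLeft K f ∘ₗ (homogeneousSubmodule (Fin 3) K m).subtype).coprod
    (LinearMap.mulLeft K g ∘ₗ (homogeneousSubmodule (Fin 3) K n).subtype)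

theorem syzygyMap_apply (f g : MvPolynomial (Fin 3) K) (m n : ℕ) (x) :
    syzygyMap f g m n x = f * x.1 + g * x.2 := by
  simp [syzygyMap]

/-- Only Koszul syzygies occur: coprimality forces `u = g * w` with `w` of degree `n`, and `u`
determines `v`. -/
theorem finrank_ker_syzygyMap_le {f g : MvPolynomial (Fin 3) K} {a : ℕ}
    (hg : g.IsHomogeneous a) (hg0 : g ≠ 0)
    (hfg : IsRelPrime f g) (n k : ℕ) :
    Module.finrank K (LinearMap.ker (syzygyMap f g (n + a) k)) ≤ (n + 2).choose 2 := by
  let m := LinearMap.mulLeft K g ∘ₗ (homogeneousSubmodule (Fin 3) K n).subtype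
  let π := ((homogeneousSubmodule (Fin 3) K (n + a)).subtype ∘ₗ LinearMap.fst K _ _).domRestrict
    (LinearMap.ker (syzygyMap f g (n + a) k))
  have hπ : Function.Injective π := by
    rintro ⟨⟨u, v⟩, huv⟩ ⟨⟨u', v'⟩, huv'⟩ h
    rw [LinearMap.mem_ker, syzygyMap_apply] at huv huv'
    have hu : (u : MvPolynomial (Fin 3) K) = u' := h
    have hv : (v : MvPolynomial (Fin 3) K) = v' := by
      refine mul_left_cancel₀ hg0 ?_
      simp only [hu] at huv
      linear_combination huv - huv'
    exact Subtype.ext (Prod.ext (Subtype.ext hu) (Subtype.ext hv))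
  have hle : LinearMap.range π ≤ LinearMap.range m := by
    rintro _ ⟨⟨⟨u, v⟩, huv⟩, rfl⟩
    rw [LinearMap.mem_ker, syzygyMap_apply] at huv
    change (u : MvPolynomial (Fin 3) K) ∈ _
    have hdvd : g ∣ f * u := ⟨-v, by linear_combination huv⟩
    obtain ⟨w, hw⟩ := hfg.symm.dvd_of_dvd_mul_left hdvd
    by_cases hu : (u : MvPolynomial (Fin 3) K) = 0
    · rw [hu]; exact zero_mem _
    have hu2 : (g * w).IsHomogeneous (n + a) := hw ▸ u.2
    have hw0 : g * w ≠ 0 := hw ▸ hu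
    obtain ⟨b, hb⟩ := exists_isHomogeneous_of_mul hu2 hw0
    have := (hg.mul hb).inj_right hu2 hw0
    obtain rfl : b = n := by omega
    exact ⟨⟨w, hb⟩, hw.symm⟩
  calc _ = Module.finrank K (LinearMap.range π) := (LinearMap.finrank_range_of_inj hπ).symm
    _ ≤ Module.finrank K (LinearMap.range m) := Submodule.finrank_mono hle
    _ ≤ Module.finrank K (homogeneousSubmodule (Fin 3) K n) := LinearMap.finrank_range_le m
    _ = _ := finrank_homogeneousSubmodule n

theorem two_mul_choose (n : ℕ) : 2 * (n + 2).choose 2 = (n + 2) * (n + 1) := by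
  rw [Nat.choose_two_right, Nat.mul_div_cancel' (Nat.even_mul_pred_self _).two_dvd]
  rfl

/-- Bézout's inequality for a curve with triple points and a curve through the same points. -/
theorem three_mul_card_le [CharZero K] {W : Finset (Plane K)} {f g : MvPolynomial (Fin 3) K}
    {d a : ℕ} (hf : f.IsHomogeneous d) (hg : g.IsHomogeneous a) (hg0 : g ≠ 0)
    (hfg : IsRelPrime f g) (hfW : f ∈ symbolicPower W 3) (hgW : ∀ P ∈ W, eval P.rep g = 0) :
    3 * W.card ≤ a * d := by
  set r := W.card with hr
  -- This makes `N = n + a + d`, with `N - 2` large enough for `six_mul_card_le_finrank`.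
  set n := 3 * r + 2 with hn
  let T := syzygyMap f g (n + a) (n + d)
  let E := secondDerivs W
  let N := 2 + (3 * r + a + d)
  let S := homogeneousSubmodule (Fin 3) K N
  have hTS : LinearMap.range T ≤ S := by
    rintro _ ⟨x, rfl⟩
    rw [syzygyMap_apply]
    have e1 : d + (n + a) = N := by omega
    have e2 : a + (n + d) = N := by omega
    exact (e1 ▸ hf.mul x.1.2).add (e2 ▸ hg.mul x.2.2)
  have hT := T.finrank_range_add_finrank_ker
  have hker : Module.finrank K (LinearMap.ker T) ≤ (n + 2).choose 2 :=
    finrank_ker_syzygyMap_le hg hg0 hfg n (n + d)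
  rw [Module.finrank_prod, finrank_homogeneousSubmodule, finrank_homogeneousSubmodule] at hT
  have hES : 6 * r ≤ Module.finrank K (S.map E) := six_mul_card_le_finrank W (by omega)
  have hET : Module.finrank K ((LinearMap.range T).map E) ≤ 3 * r := by
    refine le_trans (Submodule.finrank_mono ?_)
      (finrank_secondDerivs_mul_le W hgW (n := n + d) (by omega))
    -- Multiples of `f` have zero second derivatives on `W`, so only the multiple of `g` counts.
    rintro _ ⟨_, ⟨x, rfl⟩, rfl⟩
    refine ⟨x.2, ?_⟩
    change secondDerivs W (g * x.2) = secondDerivs W _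
    rw [syzygyMap_apply, map_add,
      secondDerivs_eq_zero (Ideal.mul_mem_right _ _ hfW), zero_add]
  have rn1 := (E.domRestrict S).finrank_range_add_finrank_ker
  have rn2 := (E.domRestrict (LinearMap.range T)).finrank_range_add_finrank_ker
  rw [LinearMap.range_domRestrict] at rn1 rn2
  -- With this inclusion of kernels, the codimension of `(f, g)` in degree `N` is at least `6r -
  -- 3r`.
  have hkk : Module.finrank K (LinearMap.ker (E.domRestrict (LinearMap.range T))) ≤
      Module.finrank K (LinearMap.ker (E.domRestrict S)) := by
    let j := (Submodule.inclusion hTS).restrict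
      (p := LinearMap.ker (E.domRestrict (LinearMap.range T)))
      (q := LinearMap.ker (E.domRestrict S)) (fun x hx => hx)
    refine LinearMap.finrank_le_finrank_of_injective (f := j) ?_
    intro x y hxy
    have := congrArg (fun z => (z.1.1 : MvPolynomial (Fin 3) K)) hxy
    exact Subtype.ext (Subtype.ext this)
  rw [finrank_homogeneousSubmodule] at rn1
  have c1 := two_mul_choose n
  have c2 := two_mul_choose (n + a)
  have c3 := two_mul_choose (n + d)
  have c4 := two_mul_choose N
  have hNn : N = n + a + d := by omega
  rw [hNn] at c4 rn1
  -- The mixed second difference of the quadratic dimension function is exactly `a * d`.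
  have key : (n + a + 2).choose 2 + (n + d + 2).choose 2 + 3 * r
      ≤ (n + a + d + 2).choose 2 + (n + 2).choose 2 := by omega
  nlinarith

/-! ### Curves through a minimal set of points -/

theorem mem_idealOf_iff {Z : Finset (Plane K)} {f : MvPolynomial (Fin 3) K} {n : ℕ}
    (hf : f.IsHomogeneous n) : f ∈ idealOf Z ↔ ∀ P ∈ Z, eval P.rep f = 0 := by
  simp only [idealOf, Submodule.mem_iInf]
  exact ⟨fun h P hP => eval_eq_zero_of_mem_pointIdeal (h P hP),
    fun h P hP => mem_pointIdeal hf (h P hP)⟩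

theorem choose_le_card_of_forall_eq_zero {W : Finset (Plane K)} {n : ℕ}
    (h : ∀ q : MvPolynomial (Fin 3) K, q.IsHomogeneous n → (∀ P ∈ W, eval P.rep q = 0) → q = 0) :
    (n + 2).choose 2 ≤ W.card := by
  let ev : homogeneousSubmodule (Fin 3) K n →ₗ[K] (W → K) :=
    LinearMap.pi fun P => (aeval (R := K) P.1.rep).toLinearMap ∘ₗ Submodule.subtype _
  have hinj : Function.Injective ev := by
    refine (injective_iff_map_eq_zero ev).2 fun q hq => Subtype.ext (h q q.2 fun P hP => ?_)
    simpa [ev, aeval_eq_eval] using congrFun hq ⟨P, hP⟩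
  have := LinearMap.finrank_le_finrank_of_injective hinj
  rwa [finrank_homogeneousSubmodule, Module.finrank_fintype_fun_eq_card, Fintype.card_coe] at this

/-- Discard points while no form of degree `n` appears; once this stops, omitting `P` admits a
nonzero form, which cannot vanish at `P`. -/
theorem exists_minimal_subset (Z : Finset (Plane K)) {n : ℕ}
    (hZ : ∀ q : MvPolynomial (Fin 3) K, q.IsHomogeneous n → (∀ P ∈ Z, eval P.rep q = 0) → q = 0) :
    ∃ W ⊆ Z,
      (∀ q : MvPolynomial (Fin 3) K, q.IsHomogeneous n → (∀ P ∈ W, eval P.rep q = 0) → q = 0) ∧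
      ∀ P ∈ W, ∃ q : MvPolynomial (Fin 3) K, q.IsHomogeneous n ∧ eval P.rep q ≠ 0 ∧
        ∀ Q ∈ W, Q ≠ P → eval Q.rep q = 0 := by
  classical
  induction Z using Finset.strongInduction with
  | H Z ih =>
    by_cases h : ∃ P ∈ Z, ∀ q : MvPolynomial (Fin 3) K, q.IsHomogeneous n →
        (∀ Q ∈ Z.erase P, eval Q.rep q = 0) → q = 0
    · obtain ⟨P, hP, hPq⟩ := h
      obtain ⟨W, hW, h1⟩ := ih _ (Finset.erase_ssubset hP) hPq
      exact ⟨W, hW.trans (Finset.erase_subset _ _), h1⟩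
    · push Not at h
      refine ⟨Z, subset_rfl, hZ, fun P hP => ?_⟩
      obtain ⟨q, hq, hq1, hq0⟩ := h P hP
      refine ⟨q, hq, fun hqP => hq0 (hZ q hq fun Q hQ => ?_), fun Q hQ hQP =>
        hq1 Q (Finset.mem_erase.2 ⟨hQP, hQ⟩)⟩
      by_cases hQP : Q = P
      · rwa [hQP]
      · exact hq1 Q (Finset.mem_erase.2 ⟨hQP, hQ⟩)

/-- Two independent linear forms through `v` cannot both be constant multiples of one nonunit. The
case `p = 0` just provides a nonzero linear form. -/
theorem exists_linear_not_dvd {v : Fin 3 → K} (hv : v ≠ 0) {p : MvPolynomial (Fin 3) K}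
    (hp : ¬ IsUnit p) :
    ∃ l : MvPolynomial (Fin 3) K, l.IsHomogeneous 1 ∧ eval v l = 0 ∧ ¬ p ∣ l := by
  by_contra! hall
  obtain ⟨i, hi⟩ := Function.ne_iff.1 hv
  have hi : v i ≠ 0 := hi
  let l : Fin 3 → MvPolynomial (Fin 3) K := fun j => C (v i) * X j - C (v j) * X i
  have hl : ∀ j, (l j).IsHomogeneous 1 := fun j =>
    (isHomogeneous_C_mul_X _ _).sub (isHomogeneous_C_mul_X _ _)
  have hdvd : ∀ j, p ∣ l j := fun j => hall _ (hl j) (by simp [l]; ring)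
  have hev : ∀ j k, k ≠ i → eval (Pi.single k 1) (l j) = if k = j then v i else 0 := by
    intro j k hk
    simp [l, Pi.single_apply, hk.symm, eq_comm]
  have hl0 : ∀ j, j ≠ i → l j ≠ 0 := by
    intro j hj h0
    have := hev j j hj
    rw [h0] at this
    exact hi (by simpa using this.symm)
  have hconst : ∀ j, j ≠ i → ∃ c, c ≠ 0 ∧ l j = p * C c := by
    intro j hj
    obtain ⟨u, hu⟩ := hdvd j
    have hpu : p * u ≠ 0 := hu ▸ hl0 j hj
    have hdeg := totalDegree_mul_of_isDomain (left_ne_zero_of_mul hpu) (right_ne_zero_of_mul hpu)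
    rw [← hu, (hl j).totalDegree (hl0 j hj)] at hdeg
    have hp0 : p.totalDegree ≠ 0 := by
      intro h0
      rw [totalDegree_eq_zero_iff_eq_C] at h0
      have hc : coeff 0 p ≠ 0 := by
        intro hc
        rw [hc, C_0] at h0
        exact left_ne_zero_of_mul hpu h0
      exact hp (h0 ▸ (isUnit_iff_ne_zero.2 hc).map C)
    have hu0 : u.totalDegree = 0 := by omega
    rw [totalDegree_eq_zero_iff_eq_C] at hu0
    refine ⟨coeff 0 u, ?_, hu0 ▸ hu⟩
    intro hc
    rw [hc, C_0] at hu0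
    exact right_ne_zero_of_mul hpu hu0
  obtain ⟨j, k, hj, hk, hjk⟩ : ∃ j k : Fin 3, j ≠ i ∧ k ≠ i ∧ j ≠ k := by
    fin_cases i
    exacts [⟨1, 2, by decide⟩, ⟨0, 2, by decide⟩, ⟨0, 1, by decide⟩]
  obtain ⟨c, hc, hc'⟩ := hconst j hj
  obtain ⟨e, he, he'⟩ := hconst k hk
  have h1 := hev j j hj
  have h2 := hev k j hj
  rw [hc'] at h1
  rw [he'] at h2
  simp only [map_mul, eval_C, if_true, if_neg hjk] at h1 h2
  rcases mul_eq_zero.1 h2 with h | h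
  · rw [h, zero_mul] at h1
    exact hi h1.symm
  · exact he h

/-- A common component `p` would miss `W`: if `p(P) = 0`, test a form separating `P` times a line
through `P`. Then the cofactor of `p` in `g` vanishes on `W` in degree at most `n`, a contradiction.
-/
theorem exists_not_dvd {W : Finset (Plane K)} {n : ℕ}
    (hW : ∀ q : MvPolynomial (Fin 3) K, q.IsHomogeneous n → (∀ P ∈ W, eval P.rep q = 0) → q = 0)
    (hsep : ∀ P ∈ W, ∃ q : MvPolynomial (Fin 3) K, q.IsHomogeneous n ∧ eval P.rep q ≠ 0 ∧
        ∀ Q ∈ W, Q ≠ P → eval Q.rep q = 0)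
    {g : MvPolynomial (Fin 3) K} (hg : g.IsHomogeneous (n + 1)) (hg0 : g ≠ 0)
    (hgW : ∀ P ∈ W, eval P.rep g = 0) {p : MvPolynomial (Fin 3) K} (hp : Irreducible p) :
    ∃ h : MvPolynomial (Fin 3) K, h.IsHomogeneous (n + 1) ∧ (∀ P ∈ W, eval P.rep h = 0) ∧
      ¬ p ∣ h := by
  by_contra! hall
  have hpP : ∀ P ∈ W, eval P.rep p ≠ 0 := by
    intro P hP hpP
    obtain ⟨q, hq, hqP, hqW⟩ := hsep P hP
    obtain ⟨l, hl, hlP, hpl⟩ := exists_linear_not_dvd P.rep_nonzero hp.not_isUnit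
    have hdvd : p ∣ q * l := by
      refine hall _ (hq.mul hl) fun Q hQ => ?_
      rw [map_mul]
      by_cases hQP : Q = P
      · rw [hQP, hlP, mul_zero]
      · rw [hqW Q hQ hQP, zero_mul]
    obtain ⟨u, rfl⟩ := (hp.prime.dvd_or_dvd hdvd).resolve_right hpl
    rw [map_mul, hpP, zero_mul] at hqP
    exact hqP rfl
  obtain ⟨u, rfl⟩ := hall g hg hgW
  obtain ⟨b, hb⟩ := exists_isHomogeneous_of_mul hg hg0
  obtain ⟨c, hc⟩ := exists_isHomogeneous_of_mul (mul_comm p u ▸ hg) (mul_comm p u ▸ hg0)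
  have hbc := (hc.mul hb).inj_right hg hg0
  have hc0 : c ≠ 0 := by
    rintro rfl
    obtain ⟨t, rfl⟩ := isHomogeneous_zero_eq_C hc
    have ht : t ≠ 0 := by
      rintro rfl
      simp at hg0
    exact hp.not_isUnit ((isUnit_iff_ne_zero.2 ht).map C)
  -- The power of `X 0` raises the degree of the cofactor to exactly `n`, using `c ≥ 1`.
  have h0 := hW (u * X 0 ^ (c - 1)) (by
      have := hb.mul ((isHomogeneous_X K (0 : Fin 3)).pow (c - 1))
      rwa [show b + 1 * (c - 1) = n by omega] at this) (fun P hP => by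
      have := hgW P hP
      rw [map_mul] at this ⊢
      rw [(mul_eq_zero.1 this).resolve_left (hpP P hP), zero_mul])
  exact mul_ne_zero (right_ne_zero_of_mul hg0) (pow_ne_zero _ (X_ne_zero _)) h0

/-- Each irreducible factor of `f` divides only a proper subspace of the forms through `W`, and over
an infinite field finitely many proper subspaces do not cover the space. -/
theorem exists_isRelPrime [Infinite K] {W : Finset (Plane K)} {n : ℕ}
    (hW : ∀ q : MvPolynomial (Fin 3) K, q.IsHomogeneous n → (∀ P ∈ W, eval P.rep q = 0) → q = 0)
    (hsep : ∀ P ∈ W, ∃ q : MvPolynomial (Fin 3) K, q.IsHomogeneous n ∧ eval P.rep q ≠ 0 ∧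
        ∀ Q ∈ W, Q ≠ P → eval Q.rep q = 0)
    {g : MvPolynomial (Fin 3) K} (hg : g.IsHomogeneous (n + 1)) (hg0 : g ≠ 0)
    (hgW : ∀ P ∈ W, eval P.rep g = 0) {f : MvPolynomial (Fin 3) K} (hf0 : f ≠ 0) :
    ∃ h : MvPolynomial (Fin 3) K, h.IsHomogeneous (n + 1) ∧ (∀ P ∈ W, eval P.rep h = 0) ∧
      h ≠ 0 ∧ IsRelPrime f h := by
  classical
  by_cases hfu : IsUnit f
  · exact ⟨g, hg, hgW, hg0, hfu.isRelPrime_left⟩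
  let V : Submodule K (MvPolynomial (Fin 3) K) :=
    homogeneousSubmodule (Fin 3) K (n + 1) ⊓
      ⨅ P ∈ W, LinearMap.ker (aeval (R := K) P.rep).toLinearMap
  have hV : ∀ h, h ∈ V ↔ h.IsHomogeneous (n + 1) ∧ ∀ P ∈ W, eval P.rep h = 0 := by
    intro h
    simp [V, Submodule.mem_iInf, aeval_eq_eval]
  let D : MvPolynomial (Fin 3) K → Subspace K V := fun p =>
    ((Ideal.span {p}).restrictScalars K).comap V.subtype
  have hD : ∀ p (h : V), h ∈ D p ↔ p ∣ (h : MvPolynomial (Fin 3) K) := by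
    intro p h
    simp [D, Ideal.mem_span_singleton]
  let F := (UniqueFactorizationMonoid.factors f).toFinset
  have htop : ⊤ ∉ F.image D := by
    rw [Finset.mem_image]
    rintro ⟨p, hp, hpt⟩
    have hpi := UniqueFactorizationMonoid.irreducible_of_factor p (Multiset.mem_toFinset.1 hp)
    obtain ⟨h, h1, h2, h3⟩ := exists_not_dvd hW hsep hg hg0 hgW hpi
    exact h3 ((hD p ⟨h, (hV h).2 ⟨h1, h2⟩⟩).1 (hpt ▸ Submodule.mem_top))
  obtain ⟨h, hh⟩ := (Set.ne_univ_iff_exists_notMem _).1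
    (Subspace.biUnion_ne_univ_of_top_notMem htop)
  have hnd : ∀ p, Irreducible p → p ∣ f → ¬ p ∣ (h : MvPolynomial (Fin 3) K) := by
    intro p hp hpf hph
    obtain ⟨q, hq, hpq⟩ := UniqueFactorizationMonoid.exists_mem_factors_of_dvd hf0 hp hpf
    apply hh
    simp only [Set.mem_iUnion]
    exact ⟨D q, Finset.mem_image_of_mem _ (Multiset.mem_toFinset.2 hq),
      (hD q h).2 (hpq.symm.dvd.trans hph)⟩
  have h12 := (hV h).1 h.2
  refine ⟨h, h12.1, h12.2, ?_, WfDvdMonoid.isRelPrime_of_no_irreducible_factors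
    (fun h0 => hf0 h0.1) fun p hp => hnd p hp⟩
  intro h0
  obtain ⟨p, hp, hpf⟩ := WfDvdMonoid.exists_irreducible_factor hfu hf0
  exact hnd p hp hpf (h0 ▸ dvd_zero p)

/-- Chudnovsky's inequality for forms vanishing to order three. -/
theorem three_mul_le_two_mul [CharZero K] {Z : Finset (Plane K)} {n d : ℕ}
    (hZ : ∀ q : MvPolynomial (Fin 3) K, q.IsHomogeneous n → (∀ P ∈ Z, eval P.rep q = 0) → q = 0)
    {g : MvPolynomial (Fin 3) K} (hg : g.IsHomogeneous (n + 1)) (hg0 : g ≠ 0)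
    (hgZ : ∀ P ∈ Z, eval P.rep g = 0) {f : MvPolynomial (Fin 3) K} (hf : f.IsHomogeneous d)
    (hf0 : f ≠ 0) (hfZ : f ∈ symbolicPower Z 3) : 3 * (n + 2) ≤ 2 * d := by
  obtain ⟨W, hWZ, hW, hsep⟩ := exists_minimal_subset Z hZ
  obtain ⟨h, hh, hhW, hh0, hrel⟩ :=
    exists_isRelPrime hW hsep hg hg0 (fun P hP => hgZ P (hWZ hP)) hf0
  have hfW : f ∈ symbolicPower W 3 := by
    simp only [symbolicPower, Submodule.mem_iInf] at hfZ ⊢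
    exact fun P hP => hfZ P (hWZ hP)
  have h1 := three_mul_card_le hf hh hh0 hrel hfW hhW
  have h2 := choose_le_card_of_forall_eq_zero hW
  have h3 := two_mul_choose n
  have h4 : (n + 1) * (3 * (n + 2)) ≤ (n + 1) * (2 * d) := by nlinarith
  exact Nat.le_of_mul_le_mul_left h4 n.succ_pos

/-! ### Initial degrees of symbolic powers -/

theorem exists_mem_symbolicPower (Z : Finset (Plane K)) (k : ℕ) :
    ∃ n, ∃ f ∈ symbolicPower Z k, f ≠ 0 ∧ f.IsHomogeneous n := by
  classical
  have hex : ∀ P : Plane K, ∃ l : MvPolynomial (Fin 3) K, l.IsHomogeneous 1 ∧ l ≠ 0 ∧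
      eval P.rep l = 0 := by
    intro P
    obtain ⟨l, h1, h2, h3⟩ := exists_linear_not_dvd P.rep_nonzero
      (p := (0 : MvPolynomial (Fin 3) K)) not_isUnit_zero
    exact ⟨l, h1, fun h => h3 (h ▸ dvd_rfl), h2⟩
  choose l h1 h2 h3 using hex
  refine ⟨_, ∏ P ∈ Z, l P ^ k, ?_, Finset.prod_ne_zero_iff.2 fun P _ => pow_ne_zero _ (h2 P),
    IsHomogeneous.prod Z _ (fun _ => 1 * k) fun P _ => (h1 P).pow k⟩
  simp only [symbolicPower, Submodule.mem_iInf]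
  exact fun P hP => Ideal.mem_of_dvd _ (Finset.dvd_prod_of_mem _ hP)
    (Ideal.pow_mem_pow (mem_pointIdeal (h1 P) (h3 P)) k)

theorem exists_initialDegree (Z : Finset (Plane K)) (k : ℕ) :
    ∃ f ∈ symbolicPower Z k, f ≠ 0 ∧ f.IsHomogeneous (initialDegree (symbolicPower Z k)) :=
  Nat.sInf_mem (exists_mem_symbolicPower Z k)

theorem initialDegree_le {I : Ideal (MvPolynomial (Fin 3) K)} {f : MvPolynomial (Fin 3) K} {n : ℕ}
    (hf : f ∈ I) (hf0 : f ≠ 0) (h : f.IsHomogeneous n) : initialDegree I ≤ n :=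
  Nat.sInf_le ⟨f, hf, hf0, h⟩

theorem eval_eq_zero_of_mem_symbolicPower {Z : Finset (Plane K)} {k : ℕ}
    {f : MvPolynomial (Fin 3) K} (hf : f ∈ symbolicPower Z (k + 1)) {P : Plane K} (hP : P ∈ Z) :
    eval P.rep f = 0 := by
  simp only [symbolicPower, Submodule.mem_iInf] at hf
  exact eval_eq_zero_of_mem_pointIdeal (Ideal.pow_le_self k.succ_ne_zero (hf P hP))

theorem degree_ne_zero_of_vanishing {f : MvPolynomial (Fin 3) K} (hf0 : f ≠ 0) {p : Fin 3 → K}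
    (hp : eval p f = 0) {n : ℕ} (hf : f.IsHomogeneous n) : n ≠ 0 := by
  rintro rfl
  obtain ⟨c, rfl⟩ := isHomogeneous_zero_eq_C hf
  rw [eval_C] at hp
  exact hf0 (by rw [hp, C_0])

theorem initialDegree_succ [CharZero K] {Z : Finset (Plane K)} (hZ : Z.Nonempty) (k : ℕ) :
    initialDegree (symbolicPower Z k) + 1 ≤ initialDegree (symbolicPower Z (k + 1)) := by
  obtain ⟨f, hf, hf0, hfn⟩ := exists_initialDegree Z (k + 1)
  obtain ⟨P, hP⟩ := hZ
  have hn := degree_ne_zero_of_vanishing hf0 (eval_eq_zero_of_mem_symbolicPower hf hP) hfn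
  obtain ⟨i, hi⟩ : ∃ i, pderiv i f ≠ 0 := by
    by_contra! h
    exact hf0 (eq_zero_of_pderiv hfn hn h)
  have := initialDegree_le (pderiv_mem_symbolicPower hf i) hi hfn.pderiv
  omega

theorem initialDegree_add [CharZero K] {Z : Finset (Plane K)} (hZ : Z.Nonempty) (k j : ℕ) :
    initialDegree (symbolicPower Z k) + j ≤ initialDegree (symbolicPower Z (k + j)) := by
  induction j with
  | zero => rfl
  | succ j ih =>
    have := initialDegree_succ hZ (k + j)
    rw [← add_assoc, ← add_assoc]
    omega

theorem isCollinear_of_initialDegree_eq_one {Z : Finset (Plane K)}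
    (h : initialDegree (idealOf Z) = 1) : IsCollinear Z := by
  have hex := exists_initialDegree Z 1
  rw [symbolicPower_one, h] at hex
  obtain ⟨f, hf, hf0, hf1⟩ := hex
  have hfP := (mem_idealOf_iff hf1).1 hf
  choose c hc using fun i => isHomogeneous_zero_eq_C (hf1.pderiv (i := i))
  let φ : Module.Dual K (Fin 3 → K) := ∑ i, c i • LinearMap.proj i
  have hφ : ∀ v, φ v = eval v f := by
    intro v
    have := congrArg (eval v) hf1.sum_X_mul_pderiv
    rw [one_smul] at this
    rw [← this]
    simp [φ, hc, mul_comm]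
  refine ⟨LinearMap.ker φ, ?_, ?_⟩
  · have hφ0 : φ ≠ 0 := by
      intro h0
      have hc0 : ∀ i, c i = 0 := fun i => by
        have := congrArg (fun ψ => ψ (Pi.single i 1)) h0
        simpa [φ, LinearMap.sum_apply, Pi.single_apply] using this
      refine hf0 ?_
      have := hf1.sum_X_mul_pderiv
      simpa [hc, hc0] using this.symm
    have := Module.Dual.finrank_ker_add_one_of_ne_zero hφ0
    rw [Module.finrank_fin_fun] at this
    omega
  · intro P hP
    rw [Projectivization.submodule_eq, Submodule.span_singleton_le_iff_mem, LinearMap.mem_ker, hφ]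
    exact hfP P hP

theorem initialDegree_eq_one_of_triple [CharZero K] {Z : Finset (Plane K)} (hZ : Z.Nonempty)
    (h : initialDegree (symbolicPower Z 3) ≤ initialDegree (idealOf Z) + 2) :
    initialDegree (idealOf Z) = 1 := by
  obtain ⟨g, hg, hg0, hgn⟩ := exists_initialDegree Z 1
  obtain ⟨f, hf, hf0, hfn⟩ := exists_initialDegree Z 3
  obtain ⟨P, hP⟩ := hZ
  have hn := degree_ne_zero_of_vanishing hg0 (eval_eq_zero_of_mem_symbolicPower hg hP) hgn
  rw [symbolicPower_one] at hg hgn hn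
  obtain ⟨n, hn'⟩ := Nat.exists_eq_succ_of_ne_zero hn
  rw [hn'] at hgn
  -- With `α = n + 1`, the bound reads `3(α + 1) ≤ 2(α + 2)`, so `α ≤ 1`.
  have := three_mul_le_two_mul (Z := Z) (n := n) (fun q hq hqZ => by
      by_contra hq0
      have := initialDegree_le ((mem_idealOf_iff hq).2 hqZ) hq0 hq
      omega) hgn hg0 ((mem_idealOf_iff hgn).1 hg) hfn hf0 hf
  omega

theorem initialDegree_idealOf_empty : initialDegree (idealOf (∅ : Finset (Plane K))) = 0 :=
  Nat.le_zero.1 (initialDegree_le (f := 1) (by simp [idealOf]) one_ne_zero (isHomogeneous_one _ _))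

theorem initialDegree_symbolicPower_empty (k : ℕ) :
    initialDegree (symbolicPower (∅ : Finset (Plane K)) k) = 0 :=
  Nat.le_zero.1
    (initialDegree_le (f := 1) (by simp [symbolicPower]) one_ne_zero (isHomogeneous_one _ _))

end

end PlanarPoints

theorem mainTheorem2 {K : Type*} [Field K] [IsAlgClosed K] [CharZero K]
    (Z : Finset (PlanarPoints.Plane K)) :
    (Z.Nonempty → ∀ k : ℕ, 1 ≤ k →
      (k : ℤ) - 1 ≤ (PlanarPoints.initialDegree (PlanarPoints.symbolicPower Z k) : ℤ)
        - (PlanarPoints.initialDegree (PlanarPoints.idealOf Z) : ℤ)) ∧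
    (∀ k : ℕ, 3 ≤ k →
      (PlanarPoints.initialDegree (PlanarPoints.symbolicPower Z k) : ℤ)
        - (PlanarPoints.initialDegree (PlanarPoints.idealOf Z) : ℤ) = (k : ℤ) - 1 →
      PlanarPoints.IsCollinear Z) ∧
    (∀ k : ℕ, 2 ≤ k →
      (∀ j : ℕ, 1 ≤ j → j ≤ k →
        (PlanarPoints.initialDegree (PlanarPoints.symbolicPower Z (j + 1)) : ℤ)
          - (PlanarPoints.initialDegree (PlanarPoints.symbolicPower Z j) : ℤ) = 1) →
      PlanarPoints.IsCollinear Z ∧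
        PlanarPoints.initialDegree (PlanarPoints.idealOf Z) = 1) := by
  open PlanarPoints in
  refine ⟨fun hZ k hk => ?_, fun k hk h => ?_, fun k hk h => ?_⟩
  · obtain ⟨j, rfl⟩ := Nat.exists_eq_add_of_le hk
    have := initialDegree_add hZ 1 j
    rw [symbolicPower_one] at this
    push_cast
    omega
  · rcases Z.eq_empty_or_nonempty with rfl | hZ
    -- For empty `Z` all initial degrees are `0`, which contradicts `k - 1 ≥ 2`.
    · rw [initialDegree_idealOf_empty, initialDegree_symbolicPower_empty] at h
      omega
    · obtain ⟨j, rfl⟩ := Nat.exists_eq_add_of_le hk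
      -- Growth from exponent `3` to `k` is at least `k - 3`, so equality at `k` leaves at most `2`
      -- between `I` and `I^(3)`.
      have := initialDegree_add hZ 3 j
      exact isCollinear_of_initialDegree_eq_one
        (initialDegree_eq_one_of_triple hZ (by push_cast at h; omega))
  · have h1 := h 1 le_rfl (by omega)
    have h2 := h 2 (by omega) hk
    rcases Z.eq_empty_or_nonempty with rfl | hZ
    · rw [initialDegree_symbolicPower_empty, initialDegree_symbolicPower_empty] at h1
      omega
    · rw [symbolicPower_one] at h1
      norm_num at h1 h2
      have := initialDegree_eq_one_of_triple hZ (by omega)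
      exact ⟨isCollinear_of_initialDegree_eq_one this, this⟩
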